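/- A Büchi game is a tuple $\mathcal G=(V,V_0,V_1,E,F)$ where $V$ is a finite set of positions, $V=V_0\,\dot\cup\,V_1$ is the disjoint decomposition into positions of Player 0 and positions of Player 1, $E\subseteq V\times V$ is a set of moves such that every position has at least one outgoing move, and $F\subseteq V$. A play from $v$ is an infinite path in $(V,E)$ starting in $v$; Player 0 wins it if it visits $F$ infinitely often. A strategy (of Player 0) from $v$ is a set $\mathcal S$ of finite paths from $v$ in $(V,E)$ that contains the one-point path $v$, is closed under nonempty prefixes, contains for each $\rho u\in\mathcal S$ with $u\in V_0$ exactly one one-step extension $\rho uu'$ with $uu'\in E$, and for each $\rho u\in\mathcal S$ with $u\in V_1$ all extensions $\rho uu'$ with $uu'\in E$. A play of $\mathcal S$ is a play from $v$ all of whose nonempty finite prefixes belong to $\mathcal S$; $\mathcal S$ is winning if Player 0 wins all its plays. $\mathcal S$ is positional if for each $u\in V_0$ the choice $u'$ made at paths $\rho u\in\mathcal S$ does not depend on $\rho$. For an edge $e=uw\in E$ let $\#_{\mathcal S}(e)\in\mathbb N\cup\{\infty\}$ be the number of paths $\rho u\in\mathcal S$ with $\rho uw\in\mathcal S$; $e$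 occurs in $\mathcal S$ if there is at least one. The monomial of $\mathcal S$, in indeterminates $X_e$ ($e\in E$) and with exponents in $\mathbb N\cup\{\infty\}$, is $\pi[\mathcal S]=\prod_{e\in E}X_e^{\#_{\mathcal S}(e)}$. A monomial $m_1$ absorbs $m_2$, written $m_1\succeq m_2$, if every exponent of $m_1$ is at most the corresponding exponent of $m_2$. A strategy $\mathcal S$ from $v$ is absorption-dominant from $v$ if there is no strategy $\mathcal S'$ from $v$ such that $\#_{\mathcal S'}(e)\le\#_{\mathcal S}(e)$ for all $e\in E$, with strict inequality for some $e\in E$. **Proposition.** Let $\mathcal S$ be a winning strategy from $v$ in a Büchi game that is absorption-dominant from $v$, and let $e=uw\in E$ be an edge with $\#_{\mathcal S}(e)=\infty$. Then there is a unique winning strategy $\mathcal S_w$ from $w$ with $\pi[\mathcal S_w]\succeq\pi[\mathcal S]$, and $\mathcal S_w$ is positional. Moreover, $\mathcal S$ admits a play in which $e$ occurs infinitely often if and only if $e$ occurs in $\mathcal S_w$. -/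

import Mathlib

/-- A Büchi game on a set `V` of positions: positions of Player 0 and of Player 1, moves, and the
target set. Every position has at least one move. (Finiteness of `V` is assumed where needed.) -/
structure BuchiGame (V : Type*) where
  V₀ : Set V
  V₁ : Set V
  E : V → V → Prop
  F : Set V
  isCompl : IsCompl V₀ V₁
  exists_move : ∀ v, ∃ w, E v w

namespace BuchiGame

variable {V : Type*} (G : BuchiGame V)

/-- The edges `vw ∈ E`, as ordered pairs of positions. -/
abbrev Edge : Type _ := {e : V × V // G.E e.1 e.2}

noncomputable instance [Finite V] : Fintype G.Edge := Fintype.ofFinite _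

/-- The nodes of the tree unraveling from `v₀`: the finite paths `v₀ v₁ … vₙ`, listed from the
root `v₀` on. The children of the node `ρ` are the nodes `ρ ++ [v]`. -/
def unraveling (v₀ : V) : Set (List V) :=
  {ρ | ρ.head? = some v₀ ∧ ρ.IsChain G.E}

/-- A play from `v₀`: an infinite path starting in `v₀`. -/
def IsPlay (v₀ : V) (p : ℕ → V) : Prop :=
  p 0 = v₀ ∧ ∀ i, G.E (p i) (p (i + 1))

/-- Player 0 wins the play `p` if it visits the target set infinitely often. -/
def IsWonBy₀ (p : ℕ → V) : Prop :=
  {i | p i ∈ G.F}.Infinite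

/-- A strategy of Player 0 from `v₀`, as a subtree of the tree unraveling from `v₀`
(containing the root). -/
@[ext]
structure Strategy (v₀ : V) where
  nodes : Set (List V)
  subset_unraveling : nodes ⊆ G.unraveling v₀
  root_mem : [v₀] ∈ nodes
  /-- prefix closure -/
  prefix_mem : ∀ (ρ : List V) (v : V), ρ ≠ [] → ρ ++ [v] ∈ nodes → ρ ∈ nodes
  /-- unique choice at positions of Player 0 -/
  unique_choice : ∀ (ρ : List V) (v : V), ρ ++ [v] ∈ nodes → v ∈ G.V₀ →
    ∃! w, G.E v w ∧ ρ ++ [v, w] ∈ nodes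
  /-- all moves of the opponent -/
  all_moves : ∀ (ρ : List V) (v : V), ρ ++ [v] ∈ nodes → v ∈ G.V₁ →
    ∀ w, G.E v w → ρ ++ [v, w] ∈ nodes

end BuchiGame

/-- Monomials over the indeterminates `X`, with exponents in `ℕ ∪ {∞}`. -/
@[ext]
structure Monomial (X : Type*) where
  exp : X → ℕ∞

namespace Monomial

variable {X : Type*}

instance : One (Monomial X) := ⟨⟨fun _ => 0⟩⟩

instance : Mul (Monomial X) := ⟨fun m₁ m₂ => ⟨fun x => m₁.exp x + m₂.exp x⟩⟩

instance : CommMonoid (Monomial X) where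
  mul_assoc a b c := Monomial.ext (funext fun _ => add_assoc _ _ _)
  one_mul a := Monomial.ext (funext fun _ => zero_add _)
  mul_one a := Monomial.ext (funext fun _ => add_zero _)
  mul_comm a b := Monomial.ext (funext fun _ => add_comm _ _)

open Classical in
/-- The indeterminate `x`, as a monomial. -/
noncomputable def var (x : X) : Monomial X := ⟨fun y => if y = x then 1 else 0⟩

/-- The power `m ^ k` with a possibly infinite exponent `k`; in `ℕ∞` one has `∞ * 0 = 0`, so the
infinitary power turns every nonzero exponent into `∞`. -/
def epow (m : Monomial X) (k : ℕ∞) : Monomial X := ⟨fun x => k * m.exp x⟩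

/-- `m₁` absorbs `m₂`, written `m₁ ⪰ m₂`: all exponents of `m₁` are at most those of `m₂`. -/
def Absorbs (m₁ m₂ : Monomial X) : Prop := ∀ x, m₁.exp x ≤ m₂.exp x

end Monomial

namespace BuchiGame

namespace Strategy

variable {V : Type*} {G : BuchiGame V} {v w : V}

/-- The number of occurrences of the edge `e = uw` in the strategy tree: the number of
nodes `ρu` of the tree such that `ρu → ρuw` is an edge of the tree. -/
noncomputable def edgeCount (S : G.Strategy v) (e : G.Edge) : ℕ∞ :=
  {ρ : List V | ρ ++ [e.1.1] ∈ S.nodes ∧ ρ ++ [e.1.1, e.1.2] ∈ S.nodes}.encard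

/-- The edge `e = uw` occurs in the strategy tree. -/
def Occurs (S : G.Strategy v) (e : G.Edge) : Prop :=
  ∃ ρ : List V, ρ ++ [e.1.1] ∈ S.nodes ∧ ρ ++ [e.1.1, e.1.2] ∈ S.nodes

/-- `S₁` absorbs `S₂`, written `S₁ ⪰ S₂`. -/
def Absorbs (S₁ : G.Strategy v) (S₂ : G.Strategy w) : Prop :=
  ∀ e, S₁.edgeCount e ≤ S₂.edgeCount e

/-- `S₁` strictly absorbs `S₂`, written `S₁ ≻ S₂`. -/
def StrictlyAbsorbs (S₁ : G.Strategy v) (S₂ : G.Strategy w) : Prop :=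
  S₁.Absorbs S₂ ∧ ∃ e, S₁.edgeCount e < S₂.edgeCount e

/-- `S` is absorption-dominant from its initial position `v`: no strategy of Player 0 from `v`
strictly absorbs it. -/
def AbsorptionDominant (S : G.Strategy v) : Prop :=
  ¬ ∃ S' : G.Strategy v, S'.StrictlyAbsorbs S

/-- `p` is a play contained in (consistent with) `S`: an infinite path through the tree from
its root. -/
def HasPlay (S : G.Strategy v) (p : ℕ → V) : Prop :=
  G.IsPlay v p ∧ ∀ n, (List.range (n + 1)).map p ∈ S.nodes

/-- All plays contained in `S` are won by Player 0. -/
def IsWinning (S : G.Strategy v) : Prop :=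
  ∀ p, S.HasPlay p → G.IsWonBy₀ p

/-- `S` plays positionally from `u`: the choice at `u` does not depend on the history. -/
def PlaysPositionallyFrom (S : G.Strategy v) (u : V) : Prop :=
  ∀ (ρ ρ' : List V) (a b : V), ρ ++ [u, a] ∈ S.nodes → ρ' ++ [u, b] ∈ S.nodes → a = b

/-- `S` is positional. -/
def IsPositional (S : G.Strategy v) : Prop :=
  ∀ u ∈ G.V₀, S.PlaysPositionallyFrom u

/-- The value of `S` under the strategy-tracking interpretation, which labels every edge `e` by
its own indeterminate `X_e`: the monomial `∏ₑ X_e ^ (number of occurrences of e in S)`. -/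
noncomputable def monomial [Finite V] (S : G.Strategy v) : Monomial G.Edge :=
  ∏ e : G.Edge, (Monomial.var e).epow (S.edgeCount e)

end Strategy

/-- The play `p` uses the edge `e = uw` infinitely often. -/
def UsesInfinitelyOften {V : Type*} (G : BuchiGame V) (p : ℕ → V) (e : G.Edge) : Prop :=
  {i | p i = e.1.1 ∧ p (i + 1) = e.1.2}.Infinite

end BuchiGame

namespace Monomial

variable {X : Type*}

/-! Let W (`infiniteTargets`) be the set of targets of edges occurring infinitely often in `S`. By
dominance, only one move of `S` occurs at each Player 0 position in W (`eq_of_mem_V₀`). Otherwise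
one could follow `S` until reaching W and then play positionally along infinitely occurring edges,
avoiding the superfluous move: new occurrences only affect exponents that are already ∞, so this
would strictly absorb `S`.

Hence every edge of `S` leaving W occurs infinitely often, and W is closed under the edges of `S`. A
strategy from `w ∈ W` that absorbs `S` uses only edges of `S`, so it stays in W and its choices are
forced, which gives uniqueness and positionality. The subtree of `S` below any occurrence of `w` is
such a strategy and inherits winning. All these subtrees thus coincide, and a return to `e` in one
of them can be iterated forever. -/

theorem exp_prod {ι : Type*} (s : Finset ι) (f : ι → Monomial X) (x : X) :
    (∏ i ∈ s, f i).exp x = ∑ i ∈ s, (f i).exp x := by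
  classical
  induction s using Finset.induction_on with
  | empty => rfl
  | insert a s ha ih => rw [Finset.prod_insert ha, Finset.sum_insert ha, ← ih]; rfl

end Monomial

namespace BuchiGame

theorem mem_V₀_or_mem_V₁ {V : Type*} (G : BuchiGame V) (a : V) : a ∈ G.V₀ ∨ a ∈ G.V₁ := by
  have h : a ∈ G.V₀ ⊔ G.V₁ := G.isCompl.sup_eq_top ▸ Set.mem_univ a
  exact h

namespace Strategy

variable {V : Type*} {G : BuchiGame V} {v w : V}

theorem exp_monomial [Finite V] (S : G.Strategy v) (e : G.Edge) :
    S.monomial.exp e = S.edgeCount e := by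
  classical
  rw [monomial, Monomial.exp_prod, Finset.sum_eq_single e]
  · simp [Monomial.epow, Monomial.var]
  · intro b _ hb
    simp [Monomial.epow, Monomial.var, hb.symm]
  · simp

theorem monomial_absorbs_iff [Finite V] (S : G.Strategy v) (T : G.Strategy w) :
    T.monomial.Absorbs S.monomial ↔ T.Absorbs S := by
  simp only [Monomial.Absorbs, Absorbs, exp_monomial]

theorem mem_of_append_mem (S : G.Strategy v) {α : List V} (hα : α ≠ []) (β : List V)
    (h : α ++ β ∈ S.nodes) : α ∈ S.nodes := by
  induction β using List.reverseRecOn with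
  | nil => simpa using h
  | append_singleton β b ih =>
    rw [← List.append_assoc] at h
    exact ih (S.prefix_mem _ b (by simp [hα]) h)

theorem mem_of_prefix (S : G.Strategy v) {α β : List V} (hα : α ≠ []) (h : α <+: β)
    (hβ : β ∈ S.nodes) : α ∈ S.nodes := by
  obtain ⟨γ, rfl⟩ := h
  exact S.mem_of_append_mem hα γ hβ

/-- The histories after which the edge `ab` occurs in `S`. -/
def histories (S : G.Strategy v) (a b : V) : Set (List V) :=
  {ρ | ρ ++ [a, b] ∈ S.nodes}

theorem edgeCount_eq (S : G.Strategy v) (e : G.Edge) :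
    S.edgeCount e = (S.histories e.1.1 e.1.2).encard := by
  unfold edgeCount histories
  congr 1
  ext ρ
  refine ⟨fun h => h.2, fun h => ⟨S.mem_of_append_mem (by simp) [e.1.2] ?_, h⟩⟩
  simpa using h

theorem edge_of_mem (S : G.Strategy v) {ρ : List V} {a b : V} (h : ρ ++ [a, b] ∈ S.nodes) :
    G.E a b := by
  have := (S.subset_unraveling h).2.right_of_append
  simpa using this

theorem histories_nonempty_of_absorbs {S : G.Strategy v} {T : G.Strategy w} (h : T.Absorbs S)
    {ρ : List V} {a b : V} (hρ : ρ ++ [a, b] ∈ T.nodes) : (S.histories a b).Nonempty := by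
  have := h ⟨(a, b), T.edge_of_mem hρ⟩
  rw [edgeCount_eq, edgeCount_eq] at this
  rw [← Set.encard_ne_zero]
  intro h0
  have h0' : (T.histories a b).encard = 0 := le_antisymm (h0 ▸ this) (zero_le)
  rw [Set.encard_eq_zero] at h0'
  exact (h0' ▸ hρ : ρ ∈ (∅ : Set (List V)))

/-- The part of `S` below the node `α ++ [w]`, as a strategy from `w`. -/
def residual (S : G.Strategy v) (α : List V) (w : V) (h : α ++ [w] ∈ S.nodes) :
    G.Strategy w where
  nodes := {τ | τ.head? = some w ∧ α ++ τ ∈ S.nodes}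
  subset_unraveling := fun _ hτ => ⟨hτ.1, (S.subset_unraveling hτ.2).2.right_of_append⟩
  root_mem := ⟨rfl, h⟩
  prefix_mem := by
    rintro ρ x hρ ⟨h1, h2⟩
    refine ⟨?_, S.mem_of_append_mem (by simp [hρ]) [x] (by simpa using h2)⟩
    cases ρ with
    | nil => exact absurd rfl hρ
    | cons a ρ => simpa using h1
  unique_choice := by
    rintro ρ x ⟨h1, h2⟩ hx
    rw [← List.append_assoc] at h2
    obtain ⟨y, hy, hu⟩ := S.unique_choice _ x h2 hx
    refine ⟨y, ⟨hy.1, ?_, by simpa using hy.2⟩, fun z hz => hu z ⟨hz.1, by simpa using hz.2.2⟩⟩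
    cases ρ <;> simpa using h1
  all_moves := by
    rintro ρ x ⟨h1, h2⟩ hx y hy
    rw [← List.append_assoc] at h2
    refine ⟨?_, by simpa using S.all_moves _ x h2 hx y hy⟩
    cases ρ <;> simpa using h1

theorem residual_absorbs (S : G.Strategy v) {α : List V} (h : α ++ [w] ∈ S.nodes) :
    (S.residual α w h).Absorbs S := by
  intro e
  rw [edgeCount_eq, edgeCount_eq]
  refine Set.encard_le_encard_of_injOn (f := fun τ => α ++ τ) ?_ ?_
  · intro τ hτ
    simpa [histories] using hτ.2
  · intro τ _ τ' _ hh
    exact List.append_cancel_left hh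

theorem hasPlay_of_mem (S : G.Strategy v) {p : ℕ → V}
    (h : ∀ n, (List.range (n + 1)).map p ∈ S.nodes) : S.HasPlay p := by
  refine ⟨⟨?_, fun i => ?_⟩, h⟩
  · simpa using (S.subset_unraveling (h 0)).1
  · refine S.edge_of_mem (ρ := (List.range i).map p) ?_
    simpa [List.range_succ] using h (i + 1)

/-- Prefixing `α` to a play of the subtree gives a play of `S`, and dropping finitely many positions
preserves infinitely many visits. -/
theorem IsWinning.residual {S : G.Strategy v} (hS : S.IsWinning) {α : List V}
    (h : α ++ [w] ∈ S.nodes) : (S.residual α w h).IsWinning := by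
  intro q hq
  let p : ℕ → V := fun n => if hn : n < α.length then α[n] else q (n - α.length)
  have hp : ∀ n, (List.range (α.length + n)).map p = α ++ (List.range n).map q := by
    intro n
    rw [List.range_add, List.map_append, List.map_map]
    congr 1
    · refine List.ext_getElem (by simp) fun i h1 h2 => ?_
      simp [p, h2]
    · refine List.map_congr_left fun i _ => ?_
      simp [p]
  have hplay : S.HasPlay p := by
    refine S.hasPlay_of_mem fun n => S.mem_of_append_mem (by simp)
      ((List.range α.length).map fun i => p (n + 1 + i)) ?_
    have : α ++ (List.range (n + 1)).map q ∈ S.nodes := (hq.2 n).2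
    rw [← hp, add_comm, List.range_add] at this
    simpa [Function.comp_def] using this
  have hinf : {i | p i ∈ G.F}.Infinite := hS p hplay
  show {i | q i ∈ G.F}.Infinite
  intro hfin
  refine hinf (((Set.finite_Iio α.length).union (hfin.image (· + α.length))).subset fun i hi => ?_)
  by_cases hl : i < α.length
  · exact Or.inl hl
  · refine Or.inr ⟨i - α.length, ?_, by simp only; omega⟩
    simpa [p, hl] using hi

/-! ### Infinitely occurring edges and the switched strategy -/

/-- The targets of the edges that occur infinitely often in `S`. -/
def infiniteTargets (S : G.Strategy v) : Set V :=
  {w | ∃ u, (S.histories u w).Infinite}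

theorem infinite_histories_of_mem_V₁ (S : G.Strategy v) {a b : V} (ha : a ∈ S.infiniteTargets)
    (ha' : a ∈ G.V₁) (hab : G.E a b) : (S.histories a b).Infinite := by
  obtain ⟨u, hu⟩ := ha
  refine (hu.image (f := fun ρ => ρ ++ [u]) fun ρ _ ρ' _ h => List.append_cancel_right h).mono ?_
  rintro _ ⟨ρ, hρ, rfl⟩
  refine S.all_moves _ _ ?_ ha' b hab
  simpa [histories] using hρ

/-- Pigeonhole: infinitely many nodes end in `a`, each with a successor among finitely many
positions. -/
theorem exists_infinite_histories_of_mem_V₀ [Finite V] (S : G.Strategy v) {a : V}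
    (ha : a ∈ S.infiniteTargets) (ha' : a ∈ G.V₀) : ∃ b, (S.histories a b).Infinite := by
  obtain ⟨u, hu⟩ := ha
  by_contra hcon
  simp only [not_exists, Set.not_infinite] at hcon
  refine (hu.image (f := fun ρ => ρ ++ [u]) fun ρ _ ρ' _ h => List.append_cancel_right h)
    ((Set.finite_iUnion hcon).subset ?_)
  rintro _ ⟨ρ, hρ, rfl⟩
  obtain ⟨b, hb, -⟩ := S.unique_choice (ρ ++ [u]) a (by simpa [histories] using hρ) ha'
  exact Set.mem_iUnion.2 ⟨b, hb.2⟩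

/-- The nodes of the strategy `switch`. -/
def switchNodes (S : G.Strategy v) (σ : V → V) : Set (List V) :=
  {ρ | ρ ∈ G.unraveling v ∧ ∀ α a b, α ++ [a, b] <+: ρ →
    (a ∈ S.infiniteTargets → a ∈ G.V₀ → b = σ a) ∧ (a ∉ S.infiniteTargets → α ++ [a, b] ∈ S.nodes)}

/-- The switched strategy never leaves W once inside. So if `a ∉ W`, its predecessor is outside W
too, and there the last step followed `S`. -/
theorem mem_of_mem_switchNodes {S : G.Strategy v} {σ : V → V}
    (hσ : ∀ a ∈ S.infiniteTargets, a ∈ G.V₀ → (S.histories a (σ a)).Infinite)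
    {ρ : List V} {a : V} (h : ρ ++ [a] ∈ S.switchNodes σ) (ha : a ∉ S.infiniteTargets) :
    ρ ++ [a] ∈ S.nodes := by
  obtain ⟨⟨h1, h2⟩, h3⟩ := h
  rcases List.eq_nil_or_concat' ρ with rfl | ⟨ρ, c, rfl⟩
  · simp only [List.nil_append, List.head?_cons, Option.some.injEq] at h1
    subst h1
    exact S.root_mem
  · rw [List.append_assoc, List.singleton_append] at h2 h3 ⊢
    have hc := h3 ρ c a (List.prefix_refl _)
    refine hc.2 fun hcW => ha ⟨c, ?_⟩
    rcases G.mem_V₀_or_mem_V₁ c with h0 | h1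
    · rw [hc.1 hcW h0]
      exact hσ c hcW h0
    · exact S.infinite_histories_of_mem_V₁ hcW h1 (by simpa using h2.right_of_append)

theorem append_mem_switchNodes {S : G.Strategy v} {σ : V → V} {ρ : List V} {a b : V}
    (h : ρ ++ [a] ∈ S.switchNodes σ) (hab : G.E a b)
    (h1 : a ∈ S.infiniteTargets → a ∈ G.V₀ → b = σ a)
    (h2 : a ∉ S.infiniteTargets → ρ ++ [a, b] ∈ S.nodes) : ρ ++ [a, b] ∈ S.switchNodes σ := by
  have heq : ρ ++ [a, b] = (ρ ++ [a]) ++ [b] := by simp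
  refine ⟨⟨?_, ?_⟩, fun α x y hxy => ?_⟩
  · have := h.1.1
    cases ρ <;> simpa using this
  · rw [heq, List.isChain_append]
    refine ⟨h.1.2, by simp, fun x hx y hy => ?_⟩
    simp at hx hy
    rwa [← hx, ← hy]
  · rw [heq, List.prefix_concat_iff] at hxy
    rcases hxy with hxy | hxy
    · have : (α ++ [x]) ++ [y] = (ρ ++ [a]) ++ [b] := by simpa using hxy
      obtain ⟨h3, hy⟩ := List.append_inj' this rfl
      obtain ⟨rfl, hx⟩ := List.append_inj' h3 rfl
      simp only [List.cons.injEq, and_true] at hx hy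
      subst hx hy
      exact ⟨h1, h2⟩
    · exact h.2 α x y hxy

/-- The strategy that follows `S` until it reaches a target of an infinitely often occurring edge,
and that uses `σ` as a positional strategy from there on. -/
def switch (S : G.Strategy v) (σ : V → V)
    (hσ : ∀ a ∈ S.infiniteTargets, a ∈ G.V₀ → (S.histories a (σ a)).Infinite) :
    G.Strategy v where
  nodes := S.switchNodes σ
  subset_unraveling := fun _ hρ => hρ.1
  root_mem := by
    refine ⟨by simp [unraveling], fun α a b h => ?_⟩
    have := h.length_le
    simp at this
  prefix_mem := by
    rintro ρ x hρ ⟨⟨h1, h2⟩, h3⟩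
    refine ⟨⟨?_, h2.left_of_append⟩, fun α a b h => h3 α a b (h.trans (List.prefix_append _ _))⟩
    cases ρ with
    | nil => exact absurd rfl hρ
    | cons a ρ => simpa using h1
  unique_choice := by
    intro ρ a h ha
    by_cases hW : a ∈ S.infiniteTargets
    · obtain ⟨α, hα⟩ := (hσ a hW ha).nonempty
      exact ⟨σ a, ⟨S.edge_of_mem hα, append_mem_switchNodes h (S.edge_of_mem hα) (fun _ _ => rfl)
        (absurd hW)⟩, fun y hy => (hy.2.2 ρ a y (List.prefix_refl _)).1 hW ha⟩
    · obtain ⟨y, hy, hu⟩ := S.unique_choice ρ a (mem_of_mem_switchNodes hσ h hW) ha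
      exact ⟨y, ⟨hy.1, append_mem_switchNodes h hy.1 (fun h' => absurd h' hW) fun _ => hy.2⟩,
        fun z hz => hu z ⟨hz.1, (hz.2.2 ρ a z (List.prefix_refl _)).2 hW⟩⟩
  all_moves := by
    intro ρ a h ha b hab
    exact append_mem_switchNodes h hab
      (fun _ h0 => absurd ha (Set.disjoint_left.1 G.isCompl.disjoint h0))
      fun hW => S.all_moves ρ a (mem_of_mem_switchNodes hσ h hW) ha b hab

/-! ### Consequences of absorption-dominance -/

theorem eq_of_mem_V₀ [Finite V] {S : G.Strategy v} (hS : S.AbsorptionDominant) {a b c : V}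
    (ha : a ∈ S.infiniteTargets) (ha' : a ∈ G.V₀) (hb : (S.histories a b).Nonempty)
    (hc : (S.histories a c).Infinite) : b = c := by
  classical
  by_contra hbc
  -- The positional choice takes an infinitely occurring edge, and `c` at `a`; elsewhere its value
  -- is irrelevant.
  have hex : ∀ x, ∃ y, x ∈ S.infiniteTargets → x ∈ G.V₀ →
      (S.histories x y).Infinite ∧ (x = a → y = c) := by
    intro x
    by_cases hx : x ∈ S.infiniteTargets ∧ x ∈ G.V₀
    · by_cases hxa : x = a
      · subst hxa
        exact ⟨c, fun _ _ => ⟨hc, fun _ => rfl⟩⟩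
      · obtain ⟨y, hy⟩ := S.exists_infinite_histories_of_mem_V₀ hx.1 hx.2
        exact ⟨y, fun _ _ => ⟨hy, fun h => absurd h hxa⟩⟩
    · exact ⟨x, fun h h' => absurd ⟨h, h'⟩ hx⟩
  choose σ hσ using hex
  have hmem : ∀ ρ x y, ρ ++ [x, y] ∈ (S.switch σ fun x h h' => (hσ x h h').1).nodes →
      (x ∈ S.infiniteTargets → x ∈ G.V₀ → y = σ x) ∧
        (x ∉ S.infiniteTargets → ρ ++ [x, y] ∈ S.nodes) :=
    fun ρ x y h => h.2 ρ x y (List.prefix_refl _)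
  obtain ⟨ρ₀, hρ₀⟩ := hb
  refine hS ⟨S.switch σ fun x h h' => (hσ x h h').1, fun e => ?_,
    ⟨(a, b), S.edge_of_mem hρ₀⟩, ?_⟩
  · rw [edgeCount_eq, edgeCount_eq]
    by_cases hinf : (S.histories e.1.1 e.1.2).Infinite
    · rw [hinf.encard_eq]
      exact le_top
    -- An edge with finite count cannot be played from W, so each of its occurrences is already one
    -- in `S`.
    · refine Set.encard_le_encard fun ρ hρ => ?_
      refine (hmem ρ _ _ hρ).2 fun hW => hinf ?_
      rcases G.mem_V₀_or_mem_V₁ e.1.1 with h0 | h1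
      · rw [(hmem ρ _ _ hρ).1 hW h0]
        exact (hσ _ hW h0).1
      · exact S.infinite_histories_of_mem_V₁ hW h1 e.2
  · rw [edgeCount_eq, edgeCount_eq]
    have h0 : (S.switch σ fun x h h' => (hσ x h h').1).histories a b = ∅ := by
      refine Set.eq_empty_of_forall_notMem fun ρ hρ => hbc ?_
      rw [(hmem ρ _ _ hρ).1 ha ha', (hσ a ha ha').2 rfl]
    simp only [h0, Set.encard_empty]
    exact Set.encard_pos.2 ⟨ρ₀, hρ₀⟩

theorem infinite_histories_of_nonempty [Finite V] {S : G.Strategy v} (hS : S.AbsorptionDominant)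
    {a b : V} (ha : a ∈ S.infiniteTargets) (hb : (S.histories a b).Nonempty) :
    (S.histories a b).Infinite := by
  rcases G.mem_V₀_or_mem_V₁ a with h0 | h1
  · obtain ⟨c, hc⟩ := S.exists_infinite_histories_of_mem_V₀ ha h0
    rwa [eq_of_mem_V₀ hS ha h0 hb hc]
  · exact S.infinite_histories_of_mem_V₁ ha h1 (S.edge_of_mem hb.choose_spec)

theorem last_mem_infiniteTargets [Finite V] {S : G.Strategy v} (hS : S.AbsorptionDominant)
    {T : G.Strategy w} (hT : T.Absorbs S) (hw : w ∈ S.infiniteTargets) (ρ : List V) :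
    ∀ a, ρ ++ [a] ∈ T.nodes → a ∈ S.infiniteTargets := by
  induction ρ using List.reverseRecOn with
  | nil =>
    intro a ha
    have := (T.subset_unraveling ha).1
    simp only [List.nil_append, List.head?_cons, Option.some.injEq] at this
    rwa [this]
  | append_singleton ρ c ih =>
    intro a ha
    have hc := ih c (T.mem_of_append_mem (by simp) [a] ha)
    exact ⟨c, infinite_histories_of_nonempty hS hc
      (histories_nonempty_of_absorbs hT (ρ := ρ) (by simpa using ha))⟩

theorem eq_of_absorbs [Finite V] {S : G.Strategy v} (hS : S.AbsorptionDominant)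
    (hw : w ∈ S.infiniteTargets) {T : G.Strategy w} (hT : T.Absorbs S)
    {ρ ρ' : List V} {a b c : V} {T' : G.Strategy w} (hT' : T'.Absorbs S) (ha : a ∈ G.V₀)
    (hb : ρ ++ [a, b] ∈ T.nodes) (hc : ρ' ++ [a, c] ∈ T'.nodes) : b = c := by
  have haW : a ∈ S.infiniteTargets := last_mem_infiniteTargets hS hT hw ρ a
    (T.mem_of_append_mem (by simp) [b] (by simpa using hb))
  exact eq_of_mem_V₀ hS haW ha (histories_nonempty_of_absorbs hT hb)
    (infinite_histories_of_nonempty hS haW (histories_nonempty_of_absorbs hT' hc))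

/-- Induction along a node: at Player 0 positions both strategies make the one move that `S` has
there, and at Player 1 positions all moves are present. -/
theorem nodes_subset_of_absorbs [Finite V] {S : G.Strategy v} (hS : S.AbsorptionDominant)
    (hw : w ∈ S.infiniteTargets) {T T' : G.Strategy w} (hT : T.Absorbs S) (hT' : T'.Absorbs S) :
    T.nodes ⊆ T'.nodes := by
  intro τ
  induction τ using List.reverseRecOn with
  | nil =>
    intro h
    simpa using (T.subset_unraveling h).1
  | append_singleton τ b ih =>
    intro h
    rcases List.eq_nil_or_concat' τ with rfl | ⟨τ, a, rfl⟩
    · have := (T.subset_unraveling h).1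
      simp only [List.nil_append, List.head?_cons, Option.some.injEq] at this
      subst this
      exact T'.root_mem
    · have hτ := ih (T.mem_of_append_mem (by simp) [b] h)
      have h' : τ ++ [a, b] ∈ T.nodes := by simpa using h
      suffices τ ++ [a, b] ∈ T'.nodes by simpa using this
      rcases G.mem_V₀_or_mem_V₁ a with h0 | h1
      · obtain ⟨c, hc, -⟩ := T'.unique_choice τ a hτ h0
        rw [eq_of_absorbs hS hw hT hT' h0 h' hc.2]
        exact hc.2
      · exact T'.all_moves τ a hτ h1 b (T.edge_of_mem h')

theorem eq_of_absorbs_of_mem_infiniteTargets [Finite V] {S : G.Strategy v}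
    (hS : S.AbsorptionDominant) (hw : w ∈ S.infiniteTargets) {T T' : G.Strategy w}
    (hT : T.Absorbs S) (hT' : T'.Absorbs S) : T = T' :=
  Strategy.ext ((nodes_subset_of_absorbs hS hw hT hT').antisymm
    (nodes_subset_of_absorbs hS hw hT' hT))

theorem append_mem_of_absorbs [Finite V] {S : G.Strategy v}
    (hS : S.AbsorptionDominant) (hw : w ∈ S.infiniteTargets) {T : G.Strategy w}
    (hT : T.Absorbs S) {α τ : List V} (hα : α ++ [w] ∈ S.nodes) (hτ : τ ∈ T.nodes) :
    α ++ τ ∈ S.nodes :=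
  (nodes_subset_of_absorbs hS hw hT (S.residual_absorbs hα) hτ).2

/-! ### Plays using the edge infinitely often -/

/-- A chain of ever longer nodes determines a play. -/
theorem exists_hasPlay_of_prefix_chain (S : G.Strategy v) (B : ℕ → List V)
    (hB : ∀ k, B k ∈ S.nodes) (hpre : ∀ k, B k <+: B (k + 1)) (hlen : ∀ k, k < (B k).length) :
    ∃ p, S.HasPlay p ∧ ∀ k i, i < (B k).length → (B k)[i]? = some (p i) := by
  have hmono : ∀ m n, m ≤ n → B m <+: B n := fun m n h =>
    Nat.le_induction (List.prefix_refl _) (fun n _ ih => ih.trans (hpre n)) n h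
  have hp : ∀ k i, i < (B k).length → (B k)[i]? = some ((B i)[i]'(hlen i)) := by
    intro k i hi
    rcases le_total k i with h | h
    · rw [List.getElem?_eq_getElem hi, (hmono k i h).getElem hi]
    · rw [List.getElem?_eq_getElem hi, (hmono i k h).getElem (hlen i)]
  refine ⟨fun i => (B i)[i]'(hlen i), S.hasPlay_of_mem fun n => ?_, hp⟩
  refine S.mem_of_prefix (by simp) (β := B n) ?_ (hB n)
  rw [List.prefix_iff_eq_take]
  refine List.ext_getElem? fun i => ?_
  have := hlen n
  by_cases hi : i < n + 1
  · rw [List.getElem?_take]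
    simp [hi, hp n i (by omega)]
  · simp [hi]

theorem exists_play_usesInfinitelyOften_iff [Finite V] {S : G.Strategy v} (hdom : S.AbsorptionDominant) {e : G.Edge}
    (he : S.edgeCount e = ⊤) {T : G.Strategy e.1.2} (hT : T.Absorbs S) :
    (∃ p : ℕ → V, S.HasPlay p ∧ G.UsesInfinitelyOften p e) ↔ T.Occurs e := by
  obtain ⟨⟨u, w⟩, huw⟩ := e
  rw [edgeCount_eq, Set.encard_eq_top_iff] at he
  simp only at he T hT
  have hw : w ∈ S.infiniteTargets := ⟨u, he⟩
  constructor
  · rintro ⟨p, hp, hinf⟩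
    obtain ⟨i, hi⟩ := hinf.nonempty
    obtain ⟨j, hj, hij⟩ := hinf.exists_gt i
    simp only [Set.mem_ofPred_eq] at hi hj
    obtain ⟨m, rfl⟩ := Nat.exists_eq_add_of_lt hij
    have hα : (List.range (i + 1)).map p ++ [w] ∈ S.nodes := by
      have := hp.2 (i + 1)
      rwa [List.range_succ, List.map_append, List.map_singleton, hi.2] at this
    -- The segment between two uses of `e` lies in the subtree after the first use, hence in `T`.
    -- For `m = 0` the uses are consecutive and `e` is a loop.
    have hmem : (List.range m).map (fun k => p (i + 1 + k)) ++ [u, w] ∈ T.nodes := by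
      refine nodes_subset_of_absorbs hdom hw (S.residual_absorbs hα) hT ⟨?_, ?_⟩
      · cases m with
        | zero =>
          have : u = w := by rw [← hj.1, ← hi.2]
          simp [this]
        | succ m => simp [List.range_succ_eq_map, hi.2]
      · have := hp.2 (i + m + 1 + 1)
        rw [show i + m + 1 + 1 + 1 = i + 1 + (m + 1 + 1) by omega, List.range_add,
          List.range_succ (n := m + 1), List.range_succ (n := m)] at this
        have h1 : p (i + 1 + m) = u := by rw [← hj.1]; congr 1; omega
        have h2 : p (i + 1 + (m + 1)) = w := by rw [← hj.2]; congr 1; omega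
        simpa [Function.comp_def, h1, h2] using this
    exact ⟨_, T.mem_of_append_mem (by simp) [w] (by simpa using hmem), hmem⟩
  · rintro ⟨ρ, -, hρ⟩
    obtain ⟨ρ₀, hρ₀⟩ := he.nonempty
    simp only at hρ
    have hhead := (T.subset_unraveling hρ).1
    obtain ⟨t, ht⟩ : ∃ t, ρ ++ [u, w] = w :: t := by
      cases ρ with
      | nil => exact ⟨[w], by simpa using hhead⟩
      | cons x ρ => exact ⟨ρ ++ [u, w], by simpa using hhead⟩
    -- `ρ` leads from `w` back to `u`, so appending `u` and `ρ` repeatedly yields ever longer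
    -- histories of `e` in `S`.
    let α : ℕ → List V := fun k => Nat.rec ρ₀ (fun _ a => a ++ [u] ++ ρ) k
    have hα : ∀ k, α (k + 1) = α k ++ [u] ++ ρ := fun k => rfl
    have hB : ∀ k, α k ++ [u, w] ∈ S.nodes := by
      intro k
      induction k with
      | zero => exact hρ₀
      | succ k ih =>
        rw [hα, List.append_assoc]
        exact append_mem_of_absorbs hdom hw hT (by simpa using ih) hρ
    have hlen : ∀ k, k ≤ (α k).length := by
      intro k
      induction k with
      | zero => simp
      | succ k ih => rw [hα]; simp; omega
    obtain ⟨p, hp, hpB⟩ := S.exists_hasPlay_of_prefix_chain (fun k => α k ++ [u, w]) hB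
      (fun k => ⟨t, by simp [hα, ht]⟩) (fun k => by have := hlen k; simp; omega)
    refine ⟨p, hp, Set.infinite_of_forall_exists_gt fun k => ⟨(α (k + 1)).length, ⟨?_, ?_⟩, hlen _⟩⟩
    · have := hpB (k + 1) (α (k + 1)).length (by simp)
      simpa using this.symm
    · have := hpB (k + 1) ((α (k + 1)).length + 1) (by simp)
      simpa using this.symm

end Strategy

end BuchiGame

theorem mainTheorem7 {V : Type*} [Finite V] (G : BuchiGame V) (v : V) (S : G.Strategy v)
    (hwin : S.IsWinning) (hdom : S.AbsorptionDominant)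
    (e : G.Edge) (he : S.edgeCount e = ⊤) :
    ∃ Sw : G.Strategy e.1.2,
      (Sw.IsWinning ∧ Sw.monomial.Absorbs S.monomial) ∧
      (∀ T : G.Strategy e.1.2, T.IsWinning → T.monomial.Absorbs S.monomial → T = Sw) ∧
      Sw.IsPositional ∧
      ((∃ p : ℕ → V, S.HasPlay p ∧ G.UsesInfinitelyOften p e) ↔ Sw.Occurs e) := by
  have hinf : (S.histories e.1.1 e.1.2).Infinite := by
    rwa [BuchiGame.Strategy.edgeCount_eq, Set.encard_eq_top_iff] at he
  have hw : e.1.2 ∈ S.infiniteTargets := ⟨e.1.1, hinf⟩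
  obtain ⟨ρ, hρ⟩ := hinf.nonempty
  have hρ' : (ρ ++ [e.1.1]) ++ [e.1.2] ∈ S.nodes := by
    simpa [BuchiGame.Strategy.histories] using hρ
  have habs := S.residual_absorbs hρ'
  refine ⟨S.residual _ _ hρ',
    ⟨hwin.residual hρ', (BuchiGame.Strategy.monomial_absorbs_iff _ _).2 habs⟩,
    fun T _ hT => BuchiGame.Strategy.eq_of_absorbs_of_mem_infiniteTargets hdom hw
      ((BuchiGame.Strategy.monomial_absorbs_iff _ _).1 hT) habs,
    fun u hu α β a b ha hb => BuchiGame.Strategy.eq_of_absorbs hdom hw habs habs hu ha hb,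
    BuchiGame.Strategy.exists_play_usesInfinitelyOften_iff hdom he habs⟩
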